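/- Notation. For symmetric $A\in\mathbb R^{n\times n}$ let $\sigma_1(A)\ge\dots\ge\sigma_n(A)$ be its singular values; $\|\cdot\|_2$ is the spectral norm. Let $c,c_1,c'>0$ be constants. There is a constant $C>0$, depending only on $c,c_1,c'$, such that the following holds. Let $1\le l\le n$, let $A\in\mathbb R^{n\times n}$ be symmetric with $\operatorname{rank}(A)>l$, put $\alpha=\max\left(\|A\|_2/n^{c/2},\ \sigma_{l+1}(A)\right)$, let $k\in\{1,\dots,l\}$ satisfy $\sigma_k(A)\ge 2\alpha$, and let $q$ be an integer with $q\ge C\log n$ (so a depth $q=O(\log n)$ suffices). Then there exists $p$ with $k\le p\le l$, not depending on the random matrix $X$ below, such that $$\sigma_p(A)\ge\tfrac32\alpha,\qquad \sigma_p(A)-\sigma_{p+1}(A)\ge\frac{\|A\|_2}{2n^{c/2+1}},$$ and the following holds. Let $X\in\mathbb R^{n\times l}$ have independent $\mathcal N(0,1)$ entries, and let $Q\in\mathbb R^{n\times r}$ have columns forming an orthonormal basis of the column span of the block Krylov matrix $[AX,(AA^T)AX,\dots,(AA^T)^qAX]$. Let $z_1,\dots,z_n$ be orthonormal eigenvectors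 of $QQ^TAQQ^T$ with eigenvalues $\tilde\lambda_1,\dots,\tilde\lambda_n$, $|\tilde\lambda_1|\ge\dots\ge|\tilde\lambda_n|$, and let $Z_p=[z_1,\dots,z_p]$, $\tilde\Lambda_p=\operatorname{diag}(\tilde\lambda_1,\dots,\tilde\lambda_p)$. Then, with probability at least $1-n^{-c'}$ over $X$ (simultaneously for all choices of $Q$ and of the eigenvectors $z_i$), $$\|AZ_p-Z_p\tilde\Lambda_p\|_2\le\frac{\|A\|_2}{n^{c_1}}.$$ -/

import Mathlib

open MeasureTheory ProbabilityTheory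
open scoped Matrix Matrix.Norms.L2Operator

/-- The `i`-th largest singular value `σ_i(A)`, one-indexed: `singularVal A 1` is the largest one.
(Mathlib's sequence of singular values is indexed from `0`.) -/
noncomputable def singularVal {n : ℕ} (A : Matrix (Fin n) (Fin n) ℝ) (i : ℕ) : ℝ :=
  (Matrix.toEuclideanLin A).singularValues (i - 1)

/-- The depth-`q` block Krylov matrix `[A X, (A Aᵀ) A X, …, (A Aᵀ)^q A X]`; the column indexed by
`(s, j)` is the `j`-th column of the block `(A Aᵀ)^s A X`. -/
def blockKrylov {n l : ℕ} (A : Matrix (Fin n) (Fin n) ℝ) (X : Matrix (Fin n) (Fin l) ℝ) (q : ℕ) :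
    Matrix (Fin n) (Fin (q + 1) × Fin l) ℝ :=
  Matrix.of fun i sj => ((A * Aᵀ) ^ (sj.1 : ℕ) * A * X) i sj.2

/-- The columns of `Q` form an orthonormal basis of the column span of `K`. -/
structure IsOrthonormalBasisOfRange {n r : ℕ} {κ : Type*} [Fintype κ]
    (Q : Matrix (Fin n) (Fin r) ℝ) (K : Matrix (Fin n) κ ℝ) : Prop where
  orthonormal : Qᵀ * Q = 1
  range_eq : LinearMap.range Q.mulVecLin = LinearMap.range K.mulVecLin

/-- The columns of `Z` are orthonormal eigenvectors of `B`, with eigenvalues `ev` listed by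
non-increasing magnitude. -/
structure IsEigendecomposition {n : ℕ} (B Z : Matrix (Fin n) (Fin n) ℝ) (ev : Fin n → ℝ) :
    Prop where
  orthonormal : Zᵀ * Z = 1
  eigen : B * Z = Z * Matrix.diagonal ev
  sorted : Antitone fun i => |ev i|

/-- The first `p` columns of a matrix. -/
def firstCols {n p : ℕ} (h : p ≤ n) (Z : Matrix (Fin n) (Fin n) ℝ) : Matrix (Fin n) (Fin p) ℝ :=
  Z.submatrix id (Fin.castLE h)

/-- The entries of `X` are independent standard Gaussian random variables. -/
structure IsGaussianBlock {Ω : Type*} [MeasurableSpace Ω] (P : Measure Ω) {n l : ℕ}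
    (X : Ω → Matrix (Fin n) (Fin l) ℝ) : Prop where
  law : ∀ i j, HasLaw (fun ω => X ω i j) (gaussianReal 0 1) P
  indep : iIndepFun (fun (ij : Fin n × Fin l) ω => X ω ij.1 ij.2) P

/-! ### Deterministic perturbation theory: power iteration, Ritz values, Ritz residuals. -/

section Spectral

variable {E : Type*} [NormedAddCommGroup E] [InnerProductSpace ℝ E] {n : ℕ}

/-! Between the indices `k` and `l + 1` the singular values fall from at least `2α` to at most `α`.
By pigeonhole (`exists_large_drop`) some `p` in the window has `σ_p ≥ 3α/2` and a drop of at least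
`α/(2l)`, which is polynomially large relative to `‖A‖`. Everything else loses only polynomial
factors in `n`, against the factor `(2/3)^(2q+1)`, so logarithmic depth suffices and crude bounds
are affordable.

Let `u_i` be eigenvectors sorted by `|λ_i|`, and `G` the `l × l` matrix of inner products of `u_1,
…, u_l` with the columns of `X`. If `y` is the `i`-th column of `G⁻¹`, then `Xy` has component 1
along `u_i` and 0 along the other leading eigenvectors. Applying `(A/λ_i)^(2q+1)` keeps it in the
Krylov space and shrinks its tail by `(σ_{l+1}/σ_p)^(2q+1) ≤ (2/3)^(2q+1)` when `i ≤ p`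
(`exists_krylov_approx`). The entries of `G⁻¹` are controlled by Gaussian anti-concentration
(`IsGaussianBlock.measure_bad_le`).

So `P = QQᵀ` nearly fixes `u_1, …, u_p`, and `A` and `B = PAP` nearly agree on them. With the gap at
`p`, this makes the leading Ritz vectors `z_j` nearly orthogonal to the trailing `u_i`, and the
residual `Az_j - Bz_j` is small (`norm_ritz_residual_le`). -/

theorem eigenvalues_eq_of_antitone [FiniteDimensional ℝ E] {T : E →ₗ[ℝ] E} (hT : T.IsSymmetric)
    (hn : Module.finrank ℝ E = n) (b : OrthonormalBasis (Fin n) ℝ E) {ν : Fin n → ℝ}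
    (hb : ∀ i, T (b i) = ν i • b i) (hν : Antitone ν) : hT.eigenvalues hn = ν := by
  have h1 : T.toMatrix b.toBasis b.toBasis = Matrix.diagonal ν := by
    ext i j
    simp [LinearMap.toMatrix_apply, Matrix.diagonal_apply, hb]
    grind
  have h2 : T.charpoly.roots = Multiset.map ν Finset.univ.val := by
    rw [← LinearMap.charpoly_toMatrix _ b.toBasis, h1, Matrix.charpoly_diagonal,
      Polynomial.roots_prod _ _ (by
        simp [Finset.prod_ne_zero_iff, Polynomial.X_sub_C_ne_zero])]
    simp
  have h3 := hT.roots_charpoly_eq_eigenvalues hn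
  rw [h2, Fin.univ_val_map, Fin.univ_val_map, Multiset.coe_eq_coe] at h3
  have h4 : List.ofFn (hT.eigenvalues hn) = List.ofFn ν :=
    List.Perm.eq_of_sortedGE (hT.eigenvalues_antitone hn).sortedGE_ofFn hν.sortedGE_ofFn h3.symm
  exact List.ofFn_injective h4

/-- Sorting by magnitude makes the squared eigenvalues an antitone eigenvalue list of `T* T = T²`,
and such a list is unique. -/
theorem exists_eigenbasis_abs_eq_singularValues [FiniteDimensional ℝ E] {T : E →ₗ[ℝ] E}
    (hT : T.IsSymmetric) (hn : Module.finrank ℝ E = n) :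
    ∃ (u : OrthonormalBasis (Fin n) ℝ E) (lam : Fin n → ℝ),
      (∀ i, T (u i) = lam i • u i) ∧ ∀ i : Fin n, |lam i| = T.singularValues i := by
  set f : Fin n → ℝ := fun i => -|hT.eigenvalues hn i| with hf
  set s := Tuple.sort f
  have hs : Monotone (f ∘ s) := Tuple.monotone_sort f
  set u := (hT.eigenvectorBasis hn).reindex s.symm with hu
  have hTu : ∀ i, T (u i) = hT.eigenvalues hn (s i) • u i := fun i => by
    simp [hu]
  refine ⟨u, fun i => hT.eigenvalues hn (s i), hTu, fun i => ?_⟩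
  have h := eigenvalues_eq_of_antitone T.isSymmetric_adjoint_comp_self hn u
    (ν := fun i => hT.eigenvalues hn (s i) ^ 2) (fun i => by
      rw [LinearMap.comp_apply, ← LinearMap.star_eq_adjoint,
        ((LinearMap.isSymmetric_iff_isSelfAdjoint T).1 hT).star_eq]
      simp only [hTu, map_smul, smul_smul, sq]) (fun i j hij => by
      have := hs hij
      simp only [hf, Function.comp, neg_le_neg_iff] at this
      exact sq_le_sq.2 this)
  have := T.sq_singularValues_fin hn i
  rw [h] at this
  rw [← abs_of_nonneg (T.singularValues_nonneg i)]
  exact (sq_eq_sq_iff_abs_eq_abs _ _).1 this.symm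

theorem inner_pow_apply {T : E →ₗ[ℝ] E} (hT : T.IsSymmetric) {u : E} {c : ℝ}
    (hu : T u = c • u) (s : ℕ) (x : E) : inner ℝ u ((T ^ s) x) = c ^ s * inner ℝ u x := by
  induction s with
  | zero => simp
  | succ s ih =>
    rw [pow_succ', Module.End.mul_apply, ← hT, hu, real_inner_smul_left, ih]; ring

theorem OrthonormalBasis.norm_le_of_abs_inner_le (u : OrthonormalBasis (Fin n) ℝ E) {v : E} {c : ℝ}
    (h : ∀ a, |inner ℝ (u a) v| ≤ c) : ‖v‖ ≤ n * c := by
  rw [← u.sum_repr' v]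
  refine (norm_sum_le _ _).trans ?_
  refine (Finset.sum_le_sum fun a _ => (?_ : _ ≤ c)).trans (by simp)
  simpa [norm_smul] using h a

/-- After rescaling, the leading components match those of `u i` exactly; only components with index
at least `l` contribute, each damped by `θ ^ s`. -/
theorem norm_pow_smul_sub_eigenvector_le {T : E →ₗ[ℝ] E} (hT : T.IsSymmetric)
    (u : OrthonormalBasis (Fin n) ℝ E) {lam : Fin n → ℝ} (hu : ∀ i, T (u i) = lam i • u i)
    {i : Fin n} (hi : lam i ≠ 0) {l s : ℕ} {x : E} {R θ : ℝ} (hθ : 0 ≤ θ)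
    (hx : ∀ a : Fin n, a.val < l → inner ℝ (u a) x = if a = i then 1 else 0) (hil : i.val < l)
    (hlam : ∀ a : Fin n, l ≤ a.val → |lam a| ≤ θ * |lam i|) (hR : ‖x‖ ≤ R) :
    ‖(lam i ^ s)⁻¹ • (T ^ s) x - u i‖ ≤ n * (θ ^ s * R) := by
  have hR0 : 0 ≤ R := (norm_nonneg _).trans hR
  refine u.norm_le_of_abs_inner_le fun a => ?_
  rw [inner_sub_right, real_inner_smul_right, inner_pow_apply hT (hu a),
    orthonormal_iff_ite.1 u.orthonormal]
  by_cases ha : a.val < l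
  · rw [hx a ha]
    split_ifs with h
    · subst h
      rw [mul_one, inv_mul_cancel₀ (pow_ne_zero _ hi), sub_self, abs_zero]; positivity
    · rw [mul_zero, mul_zero, sub_self, abs_zero]; positivity
  · have hai : a ≠ i := by rintro rfl; exact ha hil
    rw [if_neg hai, sub_zero, ← mul_assoc, abs_mul]
    refine mul_le_mul ?_ ?_ (abs_nonneg _) (by positivity)
    · rw [abs_mul, abs_inv, abs_pow, abs_pow, inv_mul_le_iff₀ (by positivity), mul_comm,
        ← mul_pow]
      exact pow_le_pow_left₀ (abs_nonneg _) (hlam a (not_lt.1 ha)) _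
    · refine (abs_real_inner_le_norm _ _).trans ?_
      simpa using hR

theorem LinearMap.IsSymmetric.norm_apply_le_of_idempotent {P : E →ₗ[ℝ] E} (hP : P.IsSymmetric)
    (hPP : ∀ x, P (P x) = P x) (x : E) : ‖P x‖ ≤ ‖x‖ := by
  have h : ‖P x‖ * ‖P x‖ ≤ ‖x‖ * ‖P x‖ := by
    rw [← real_inner_self_eq_norm_mul_norm, hP, hPP]
    exact real_inner_le_norm _ _
  rcases (norm_nonneg (P x)).eq_or_lt with h0 | h0
  · rw [← h0]; exact norm_nonneg _
  · exact le_of_mul_le_mul_right h h0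

theorem OrthonormalBasis.norm_sq_apply_eq (u : OrthonormalBasis (Fin n) ℝ E) {T : E →ₗ[ℝ] E}
    (hT : T.IsSymmetric) {lam : Fin n → ℝ} (hu : ∀ i, T (u i) = lam i • u i) (v : E) :
    ‖T v‖ ^ 2 = ∑ a, lam a ^ 2 * inner ℝ (u a) v ^ 2 := by
  rw [← u.sum_sq_inner_right]
  refine Finset.sum_congr rfl fun a _ => ?_
  rw [← hT, hu, real_inner_smul_left, mul_pow]

theorem isSymmetric_compression {P T : E →ₗ[ℝ] E} (hT : T.IsSymmetric) (hP : P.IsSymmetric) :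
    (P ∘ₗ T ∘ₗ P).IsSymmetric := fun x y => by
  simp only [LinearMap.comp_apply]
  rw [hP, hT, hP]

/-- Ritz values are dominated in magnitude by the eigenvalues. -/
theorem abs_ritz_value_le {T P : E →ₗ[ℝ] E} (hT : T.IsSymmetric)
    (hP : P.IsSymmetric) (hPP : ∀ x, P (P x) = P x)
    (u : OrthonormalBasis (Fin n) ℝ E) {lam : Fin n → ℝ} (hu : ∀ i, T (u i) = lam i • u i)
    (hlam : Antitone fun i => |lam i|)
    (z : OrthonormalBasis (Fin n) ℝ E) {ev : Fin n → ℝ}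
    (hz : ∀ i, (P ∘ₗ T ∘ₗ P) (z i) = ev i • z i) (hev : Antitone fun i => |ev i|) (p : Fin n) :
    |ev p| ≤ |lam p| := by
  by_cases h0 : ev p = 0
  · rw [h0, abs_zero]; exact abs_nonneg _
  have hBs := isSymmetric_compression hT hP
  let e : Fin (p + 1) → Fin n := Fin.castLE p.2
  have he : Function.Injective e := Fin.castLE_injective _
  let Z : (Fin (p + 1) → ℝ) →ₗ[ℝ] E := Fintype.linearCombination ℝ fun j => z (e j)
  -- Courant–Fischer dimension count: `p` orthogonality conditions on `p + 1` coefficients leave a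
  -- nonzero `v` in the span of the leading `z`'s.
  let L : (Fin (p + 1) → ℝ) →ₗ[ℝ] (Fin p → ℝ) :=
    LinearMap.pi fun i => (innerₗ E (u (Fin.castLE p.2.le i))) ∘ₗ Z
  obtain ⟨c, hc, hc0⟩ := (Submodule.ne_bot_iff _).1
    (LinearMap.ker_ne_bot_of_finrank_lt (f := L) (by simp))
  set v : E := ∑ j, c j • z (e j) with hv
  have hZc : Z c = v := by simp [Z, hv, Fintype.linearCombination_apply]
  have hv0 : v ≠ 0 := by
    intro h
    have hli := (z.orthonormal.comp e he).linearIndependent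
    exact hc0 (funext (Fintype.linearIndependent_iff.1 hli c h))
  have huv : ∀ i : Fin n, i < p → inner ℝ (u i) v = 0 := by
    intro i hi
    have := congrFun (LinearMap.mem_ker.1 hc) ⟨i, hi⟩
    simpa [L, hZc] using this
  have hzv : ∀ a : Fin n, p < a → inner ℝ (z a) v = 0 := by
    intro a ha
    rw [hv, inner_sum]
    refine Finset.sum_eq_zero fun j _ => ?_
    rw [real_inner_smul_right, orthonormal_iff_ite.1 z.orthonormal, if_neg, mul_zero]
    rintro rfl
    have := j.2
    simp only [e, Fin.lt_def, Fin.val_castLE] at ha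
    omega
  -- Ritz vectors with nonzero Ritz value lie in the range of `P`; this is why `ev p = 0` was split
  -- off.
  have hPv : P v = v := by
    rw [hv, map_sum]
    refine Finset.sum_congr rfl fun j _ => ?_
    rw [map_smul]
    congr 1
    have hj : ev (e j) ≠ 0 := by
      have h1 : |ev p| ≤ |ev (e j)| := hev (by
        have := j.2
        simp only [e, Fin.le_def, Fin.val_castLE]; omega)
      intro h2
      rw [h2, abs_zero] at h1
      exact h0 (abs_eq_zero.1 (le_antisymm h1 (abs_nonneg _)))
    have h3 : P (ev (e j) • z (e j)) = ev (e j) • z (e j) := by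
      rw [← hz]; simp [hPP]
    rw [map_smul] at h3
    exact smul_right_injective E hj h3
  have h1 : ‖(P ∘ₗ T ∘ₗ P) v‖ ≤ ‖T v‖ := by
    simp only [LinearMap.comp_apply, hPv]
    exact hP.norm_apply_le_of_idempotent hPP _
  have h2 : ‖T v‖ ^ 2 ≤ lam p ^ 2 * ‖v‖ ^ 2 := by
    rw [u.norm_sq_apply_eq hT hu, ← u.sum_sq_inner_right, Finset.mul_sum]
    refine Finset.sum_le_sum fun a _ => ?_
    rcases lt_or_ge a p with ha | ha
    · simp [huv a ha]
    · exact mul_le_mul_of_nonneg_right (sq_le_sq.2 (hlam ha)) (sq_nonneg _)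
  have h3 : ev p ^ 2 * ‖v‖ ^ 2 ≤ ‖(P ∘ₗ T ∘ₗ P) v‖ ^ 2 := by
    rw [z.norm_sq_apply_eq hBs hz, ← z.sum_sq_inner_right, Finset.mul_sum]
    refine Finset.sum_le_sum fun a _ => ?_
    rcases lt_or_ge p a with ha | ha
    · simp [hzv a ha]
    · exact mul_le_mul_of_nonneg_right (sq_le_sq.2 (hev ha)) (sq_nonneg _)
  have h4 := h3.trans ((pow_le_pow_left₀ (norm_nonneg _) h1 2).trans h2)
  exact sq_le_sq.1 (le_of_mul_le_mul_right h4 (by positivity))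

/-- The squared overlaps form a doubly stochastic matrix, so its two off-diagonal blocks relative to
`S` have equal mass. -/
theorem sum_sq_inner_compl_comm (u z : OrthonormalBasis (Fin n) ℝ E) (S : Finset (Fin n)) :
    ∑ j ∈ S, ∑ i ∈ Sᶜ, inner ℝ (z j) (u i) ^ 2 = ∑ i ∈ S, ∑ j ∈ Sᶜ, inner ℝ (z j) (u i) ^ 2 := by
  have h1 : ∑ j ∈ S, (∑ i ∈ S, inner ℝ (z j) (u i) ^ 2 + ∑ i ∈ Sᶜ, inner ℝ (z j) (u i) ^ 2)
      = ∑ j ∈ S, (1 : ℝ) := Finset.sum_congr rfl fun j _ => by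
    rw [Finset.sum_add_sum_compl, u.sum_sq_inner_left, z.norm_eq_one, one_pow]
  have h2 : ∑ i ∈ S, (∑ j ∈ S, inner ℝ (z j) (u i) ^ 2 + ∑ j ∈ Sᶜ, inner ℝ (z j) (u i) ^ 2)
      = ∑ j ∈ S, (1 : ℝ) := Finset.sum_congr rfl fun i _ => by
    rw [Finset.sum_add_sum_compl, z.sum_sq_inner_right, u.norm_eq_one, one_pow]
  rw [Finset.sum_add_distrib] at h1 h2
  rw [Finset.sum_comm] at h2
  linarith

/-- Residual of the leading Ritz pairs when the trial space nearly contains the leading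
eigenvectors and the spectrum has a gap. -/
theorem norm_ritz_residual_le {T P : E →ₗ[ℝ] E} (hT : T.IsSymmetric)
    (hP : P.IsSymmetric) (hPP : ∀ x, P (P x) = P x)
    (u : OrthonormalBasis (Fin n) ℝ E) {lam : Fin n → ℝ} (hu : ∀ i, T (u i) = lam i • u i)
    (hlam : Antitone fun i => |lam i|)
    (z : OrthonormalBasis (Fin n) ℝ E) {ev : Fin n → ℝ}
    (hz : ∀ i, (P ∘ₗ T ∘ₗ P) (z i) = ev i • z i) (hev : Antitone fun i => |ev i|)
    {N g ε : ℝ} (hN : ∀ x, ‖T x‖ ≤ N * ‖x‖) (hN0 : 0 ≤ N) (hg : 0 < g) (hε0 : 0 ≤ ε) {p : ℕ}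
    (hε : ∀ i : Fin n, i.val < p → ‖P (u i) - u i‖ ≤ ε)
    (hgap : ∀ i j : Fin n, i.val < p → p ≤ j.val → g ≤ |lam i| - |lam j|)
    {j : Fin n} (hj : j.val < p) :
    ‖T (z j) - ev j • z j‖ ≤ n * (2 * ε * N + 2 * N * (n * (2 * ε * N / g))) := by
  set B := P ∘ₗ T ∘ₗ P with hB
  have hBs : B.IsSymmetric := isSymmetric_compression hT hP
  have hBu : ∀ i : Fin n, i.val < p → ‖T (u i) - B (u i)‖ ≤ 2 * ε * N := by
    intro i hi
    have h1 : T (u i) - B (u i) = -(lam i • (P (u i) - u i)) - P (T (P (u i) - u i)) := by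
      simp only [hB, LinearMap.comp_apply, map_sub, hu, map_smul, smul_sub]
      abel
    have h2 : |lam i| ≤ N := by
      have := hN (u i)
      rwa [hu, norm_smul, u.norm_eq_one, mul_one, mul_one] at this
    rw [h1]
    refine (norm_sub_le _ _).trans ?_
    rw [norm_neg, norm_smul, Real.norm_eq_abs]
    have h3 : |lam i| * ‖P (u i) - u i‖ ≤ N * ε :=
      mul_le_mul h2 (hε i hi) (norm_nonneg _) hN0
    have h4 : ‖P (T (P (u i) - u i))‖ ≤ N * ε :=
      (hP.norm_apply_le_of_idempotent hPP _).trans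
        ((hN _).trans (mul_le_mul_of_nonneg_left (hε i hi) hN0))
    linarith
  -- Pairing `(T - B) u_i` with `z_k` produces the factor `lam i - ev k`, which is at least `g` in
  -- magnitude because `|ev k| ≤ |lam k|`.
  have hcross : ∀ i k : Fin n, i.val < p → p ≤ k.val →
      |inner ℝ (z k) (u i)| ≤ 2 * ε * N / g := by
    intro i k hi hk
    have h1 : inner ℝ (z k) (T (u i) - B (u i)) = (lam i - ev k) * inner ℝ (z k) (u i) := by
      rw [inner_sub_right, ← hBs, hz, hu, real_inner_smul_left, real_inner_smul_right]; ring
    have h2 : g ≤ |lam i - ev k| := by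
      have h3 := abs_ritz_value_le hT hP hPP u hu hlam z hz hev k
      have h4 := hgap i k hi hk
      have h5 := abs_sub_abs_le_abs_sub (lam i) (ev k)
      linarith
    rw [le_div_iff₀ hg, mul_comm]
    calc g * |inner ℝ (z k) (u i)| ≤ |lam i - ev k| * |inner ℝ (z k) (u i)| :=
          mul_le_mul_of_nonneg_right h2 (abs_nonneg _)
      _ = |inner ℝ (z k) (T (u i) - B (u i))| := by rw [h1, abs_mul]
      _ ≤ ‖z k‖ * ‖T (u i) - B (u i)‖ := abs_real_inner_le_norm _ _
      _ ≤ 2 * ε * N := by rw [z.norm_eq_one, one_mul]; exact hBu i hi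
  set δ := 2 * ε * N / g with hδ
  have hδ0 : 0 ≤ δ := by positivity
  -- The other off-diagonal block of overlaps, trailing `u` against leading `z`, is reached through
  -- the equality of block masses.
  have hcross' : ∀ i : Fin n, p ≤ i.val → |inner ℝ (z j) (u i)| ≤ n * δ := by
    intro i hi
    let S : Finset (Fin n) := {a | a.val < p}
    have hjS : j ∈ S := by simp [S, hj]
    have hiS : i ∈ Sᶜ := by simp [S, hi]
    have h1 : inner ℝ (z j) (u i) ^ 2 ≤ ∑ j ∈ S, ∑ i ∈ Sᶜ, inner ℝ (z j) (u i) ^ 2 :=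
      (Finset.single_le_sum (f := fun i => inner ℝ (z j) (u i) ^ 2)
        (fun _ _ => sq_nonneg _) hiS).trans
      (Finset.single_le_sum (f := fun j => ∑ i ∈ Sᶜ, inner ℝ (z j) (u i) ^ 2)
        (fun _ _ => Finset.sum_nonneg fun _ _ => sq_nonneg _) hjS)
    rw [sum_sq_inner_compl_comm] at h1
    have h2 : ∑ i ∈ S, ∑ j ∈ Sᶜ, inner ℝ (z j) (u i) ^ 2 ≤ ∑ i ∈ S, ∑ j ∈ Sᶜ, δ ^ 2 := by
      refine Finset.sum_le_sum fun a ha => Finset.sum_le_sum fun b hb => ?_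
      rw [← sq_abs]
      refine pow_le_pow_left₀ (abs_nonneg _) (hcross a b ?_ ?_) 2
      · simpa [S] using ha
      · simpa [S] using hb
    have h3 : ∑ i ∈ S, ∑ j ∈ Sᶜ, δ ^ 2 ≤ (n * δ) ^ 2 := by
      simp only [Finset.sum_const, nsmul_eq_mul]
      have hS : ∀ s : Finset (Fin n), (s.card : ℝ) ≤ n := fun s => by
        exact_mod_cast (Finset.card_le_univ s).trans (by simp)
      calc (S.card : ℝ) * (Sᶜ.card * δ ^ 2) ≤ n * (n * δ ^ 2) :=
            mul_le_mul (hS _) (mul_le_mul_of_nonneg_right (hS _) (sq_nonneg _))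
              (by positivity) (by positivity)
        _ = _ := by ring
    exact abs_le_of_sq_le_sq (h1.trans (h2.trans h3)) (by positivity)
  -- As `ev j • z j = B (z j)`, the residual is `(T - B) z_j`. Leading terms have small vectors,
  -- trailing ones small coefficients.
  have hdec : T (z j) - ev j • z j = ∑ i, inner ℝ (u i) (z j) • (T (u i) - B (u i)) := by
    rw [← hz j]
    conv_lhs => rw [← u.sum_repr' (z j)]
    simp only [map_sum, map_smul, ← Finset.sum_sub_distrib, smul_sub]
  rw [hdec]
  refine (norm_sum_le _ _).trans ?_
  refine (Finset.sum_le_sum fun i _ =>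
    (?_ : _ ≤ 2 * ε * N + 2 * N * (n * δ))).trans (by simp [mul_add])
  rw [norm_smul, Real.norm_eq_abs]
  rcases lt_or_ge i.val p with hi | hi
  · have h1 : |inner ℝ (u i) (z j)| ≤ 1 := by
      refine (abs_real_inner_le_norm _ _).trans ?_
      simp
    have h2 := mul_le_mul h1 (hBu i hi) (norm_nonneg _) zero_le_one
    have h3 : 0 ≤ 2 * N * (n * δ) := by positivity
    linarith
  · have h1 : ‖T (u i) - B (u i)‖ ≤ 2 * N := by
      have h2 : ‖T (u i)‖ ≤ N := by simpa using hN (u i)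
      have h3 : ‖B (u i)‖ ≤ N := by
        refine (hP.norm_apply_le_of_idempotent hPP _).trans ((hN _).trans ?_)
        refine mul_le_of_le_one_right hN0 ?_
        simpa using hP.norm_apply_le_of_idempotent hPP (u i)
      exact (norm_sub_le _ _).trans (by linarith)
    have h2 := mul_le_mul (hcross' i hi) h1 (norm_nonneg _) (by positivity)
    rw [real_inner_comm] at h2
    have h3 : 0 ≤ 2 * ε * N := by positivity
    linarith

end Spectral

/-! ### Anti-concentration and conditioning of Gaussian blocks. -/

section Gaussian

/-- The density is at most `1 / (2√v)`, since `2π ≥ 4`, and the interval has length `2t√v`. -/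
theorem gaussianReal_abs_le {v : NNReal} (hv : v ≠ 0) (t : ℝ) :
    gaussianReal 0 v {x | |x| ≤ t * √v} ≤ ENNReal.ofReal t := by
  have hset : {x : ℝ | |x| ≤ t * √v} = Set.Icc (-(t * √v)) (t * √v) := by
    ext x; simp [abs_le]
  have hv' : (0 : ℝ) < v := by positivity
  rw [hset, gaussianReal_apply _ hv]
  have hpdf : ∀ x, gaussianPDF 0 v x ≤ ENNReal.ofReal (1 / (2 * √v)) := fun x => by
    rw [gaussianPDF_def]
    refine ENNReal.ofReal_le_ofReal ?_
    rw [gaussianPDFReal_def]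
    have h1 : Real.exp (-(x - 0) ^ 2 / (2 * v)) ≤ 1 := by
      rw [Real.exp_le_one_iff]
      exact div_nonpos_of_nonpos_of_nonneg (neg_nonpos.2 (sq_nonneg _)) (by positivity)
    have h2 : 2 * √v ≤ √(2 * Real.pi * v) := by
      have h3 : 2 * √(v : ℝ) = √(4 * v) := by
        rw [Real.sqrt_mul (by norm_num), show (4 : ℝ) = 2 ^ 2 by norm_num,
          Real.sqrt_sq (by norm_num)]
      rw [h3]
      apply Real.sqrt_le_sqrt
      nlinarith [Real.pi_gt_three]
    calc (√(2 * Real.pi * v))⁻¹ * Real.exp (-(x - 0) ^ 2 / (2 * v))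
        ≤ (√(2 * Real.pi * v))⁻¹ * 1 := by gcongr
      _ ≤ 1 / (2 * √v) := by rw [mul_one, one_div]; gcongr
  calc ∫⁻ x in Set.Icc (-(t * √v)) (t * √v), gaussianPDF 0 v x
      ≤ ∫⁻ x in Set.Icc (-(t * √v)) (t * √v), ENNReal.ofReal (1 / (2 * √v)) :=
        lintegral_mono hpdf
    _ = ENNReal.ofReal (1 / (2 * √v)) * ENNReal.ofReal (t * √v - -(t * √v)) := by
        rw [setLIntegral_const, Real.volume_Icc]
    _ = ENNReal.ofReal t := by
        rw [← ENNReal.ofReal_mul (by positivity)]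
        congr 1
        field_simp
        ring

theorem stdGaussian_abs_inner_le {E : Type*} [NormedAddCommGroup E] [InnerProductSpace ℝ E]
    [FiniteDimensional ℝ E] [MeasurableSpace E] [BorelSpace E] {w : E} (hw : w ≠ 0) (t : ℝ) :
    stdGaussian E {x | |inner ℝ w x| ≤ t * ‖w‖} ≤ ENNReal.ofReal t := by
  have h1 := IsGaussian.map_eq_gaussianReal (μ := stdGaussian E) (innerSL ℝ w)
  rw [integral_strongDual_stdGaussian, variance_dual_stdGaussian, innerSL_apply_norm] at h1
  have hw' : 0 < ‖w‖ := norm_pos_iff.2 hw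
  have hv : (‖w‖ ^ 2).toNNReal ≠ 0 := by
    rw [Ne, Real.toNNReal_eq_zero, not_le]; positivity
  have h2 := gaussianReal_abs_le hv t
  rw [Real.coe_toNNReal _ (sq_nonneg _), Real.sqrt_sq hw'.le, ← h1, Measure.map_apply
    (by fun_prop) (measurableSet_le (by fun_prop) (by fun_prop))] at h2
  exact h2

variable {n l : ℕ}

/-- Anti-concentration of a column along a direction determined by the other columns. -/
theorem pi_stdGaussian_abs_inner_le
    {w : (Fin l → EuclideanSpace ℝ (Fin n)) → EuclideanSpace ℝ (Fin n)} (hw : Measurable w)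
    (j : Fin l) (hwj : ∀ x y, w (Function.update x j y) = w x) (t : ℝ) :
    Measure.pi (fun _ : Fin l => stdGaussian (EuclideanSpace ℝ (Fin n)))
      {x | w x ≠ 0 ∧ |inner ℝ (w x) (x j)| ≤ t * ‖w x‖} ≤ ENNReal.ofReal t := by
  set μ : Fin l → Measure (EuclideanSpace ℝ (Fin n)) :=
    fun _ => stdGaussian (EuclideanSpace ℝ (Fin n)) with hμ
  set S := {x : Fin l → EuclideanSpace ℝ (Fin n) |
    w x ≠ 0 ∧ |inner ℝ (w x) (x j)| ≤ t * ‖w x‖} with hSdef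
  have hS : MeasurableSet S := by
    refine MeasurableSet.inter (measurableSet_eq_fun hw measurable_const).compl ?_
    exact measurableSet_le (f := fun x => |inner ℝ (w x) (x j)|) (g := fun x => t * ‖w x‖)
      (by fun_prop) (by fun_prop)
  have hf : Measurable (S.indicator (1 : (Fin l → EuclideanSpace ℝ (Fin n)) → ENNReal)) :=
    measurable_one.indicator hS
  rw [← lintegral_indicator_one hS]
  have key : ∫⁻ x, S.indicator 1 x ∂Measure.pi μ
      ≤ ∫⁻ x, ENNReal.ofReal t ∂Measure.pi μ := by
    -- Integrate over the `j`-th column alone, the others being frozen: `w` is then a fixed vector.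
    refine lintegral_le_of_lmarginal_le {j} hf measurable_const ?_
    rw [lmarginal_singleton, lmarginal_singleton]
    intro x
    simp only [lintegral_const, measure_univ, mul_one]
    by_cases hx : w x = 0
    · refine le_trans (le_of_eq ?_) zero_le
      rw [← lintegral_zero (μ := μ j)]
      refine lintegral_congr fun y => ?_
      rw [Set.indicator_of_notMem]
      simp [hSdef, hwj, hx]
    · refine le_trans (le_of_eq ?_) (stdGaussian_abs_inner_le hx t)
      rw [← lintegral_indicator_one (measurableSet_le (by fun_prop) (by fun_prop))]
      refine lintegral_congr fun y => ?_
      simp only [Set.indicator_apply, hSdef, Set.mem_ofPred_eq, hwj, Function.update_self, hx,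
        ne_eq, not_false_eq_true, true_and, Pi.one_apply]
  simpa using key

/-- The matrix of inner products of the family `u` with the family `x`. -/
def gramMatrix {E : Type*} [NormedAddCommGroup E] [InnerProductSpace ℝ E] {ι κ : Type*}
    (u : ι → E) (x : κ → E) : Matrix ι κ ℝ := Matrix.of fun i j => inner ℝ (u i) (x j)

theorem Measurable.matrix_det {α ι : Type*} [MeasurableSpace α] [Fintype ι] [DecidableEq ι]
    {M : α → Matrix ι ι ℝ} (hM : ∀ i j, Measurable fun a => M a i j) :
    Measurable fun a => (M a).det := by
  simp only [Matrix.det_apply]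
  refine Finset.measurable_sum _ fun σ _ => ?_
  refine Measurable.const_smul ?_ _
  exact Finset.measurable_prod _ fun i _ => hM _ _

theorem measurable_gramMatrix_apply {ι : Type*} (u : ι → EuclideanSpace ℝ (Fin n)) (i : ι)
    (j : Fin l) : Measurable fun x : Fin l → EuclideanSpace ℝ (Fin n) => gramMatrix u x i j := by
  simp only [gramMatrix, Matrix.of_apply]; fun_prop

theorem measurable_gramMatrix_adjugate (u : Fin l → EuclideanSpace ℝ (Fin n)) (i j : Fin l) :
    Measurable fun x : Fin l → EuclideanSpace ℝ (Fin n) => (gramMatrix u x).adjugate i j := by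
  simp only [Matrix.adjugate_apply]
  refine Measurable.matrix_det fun a b => ?_
  simp only [Matrix.updateRow_apply]
  split_ifs
  · exact measurable_const
  · exact measurable_gramMatrix_apply u a b

theorem inner_sum_smul_gramMatrix {ι κ : Type*} [Fintype ι] {E : Type*} [NormedAddCommGroup E]
    [InnerProductSpace ℝ E] (u : ι → E) (x : κ → E) (c : ι → ℝ) (j : κ) :
    inner ℝ (∑ i, c i • u i) (x j) = ∑ i, gramMatrix u x i j * c i := by
  simp [sum_inner, real_inner_smul_left, gramMatrix, mul_comm]

theorem Orthonormal.sum_smul_ne_zero {ι : Type*} [Fintype ι] {E : Type*} [NormedAddCommGroup E]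
    [InnerProductSpace ℝ E] {u : ι → E} (hu : Orthonormal ℝ u) {c : ι → ℝ} {i : ι}
    (hc : c i ≠ 0) : ∑ i, c i • u i ≠ 0 := by
  intro h
  exact hc (Fintype.linearIndependent_iff.1 hu.linearIndependent c h i)

/-- Induction on leading minors: expanded along its last column, a minor is the inner product of
that column with a vector of cofactors free of it. One cofactor is the previous minor, so this
vector is almost surely nonzero. -/
theorem ae_gramMatrix_minor_ne_zero {u : Fin l → EuclideanSpace ℝ (Fin n)} (hu : Orthonormal ℝ u)
    (m : ℕ) (hm : m ≤ l) :
    ∀ᵐ x ∂Measure.pi (fun _ : Fin l => stdGaussian (EuclideanSpace ℝ (Fin n))),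
      ((gramMatrix u x).submatrix (Fin.castLE hm) (Fin.castLE hm)).det ≠ 0 := by
  induction m with
  | zero => exact Filter.Eventually.of_forall fun x => by simp
  | succ m ih =>
    specialize ih (Nat.le_of_succ_le hm)
    let c : Fin (m + 1) → (Fin l → EuclideanSpace ℝ (Fin n)) → ℝ := fun i x =>
      (-1) ^ (i + Fin.last m : ℕ) *
        (((gramMatrix u x).submatrix (Fin.castLE hm) (Fin.castLE hm)).submatrix i.succAbove
          (Fin.last m).succAbove).det
    let u' : Fin (m + 1) → EuclideanSpace ℝ (Fin n) := fun i => u (Fin.castLE hm i)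
    have hu' : Orthonormal ℝ u' := hu.comp _ (Fin.castLE_injective hm)
    let j : Fin l := Fin.castLE hm (Fin.last m)
    have hc : ∀ i, Measurable (c i) := fun i =>
      (Measurable.matrix_det fun a b => measurable_gramMatrix_apply u _ _).const_mul _
    have hcj : ∀ i x y, c i (Function.update x j y) = c i x := fun i x y => by
      simp only [c]
      congr 2
      ext a b
      simp only [Matrix.submatrix_apply, gramMatrix, Matrix.of_apply]
      rw [Function.update_of_ne]
      intro h
      have := Fin.castLE_injective hm h
      exact Fin.succAbove_ne _ _ this
    -- With `t = 0`, anti-concentration says that the inner product almost surely does not vanish.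
    have h0 := pi_stdGaussian_abs_inner_le (w := fun x => ∑ i, c i x • u' i)
      (Finset.measurable_sum _ fun i _ => (hc i).smul_const _) j
      (fun x y => by simp only [hcj]) 0
    have h1 : ∀ᵐ x ∂Measure.pi (fun _ : Fin l => stdGaussian (EuclideanSpace ℝ (Fin n))),
        ¬ (∑ i, c i x • u' i ≠ 0 ∧
          |inner ℝ (∑ i, c i x • u' i) (x j)| ≤ 0 * ‖∑ i, c i x • u' i‖) := by
      rw [ae_iff]
      simpa only [not_not, ENNReal.ofReal_zero, nonpos_iff_eq_zero] using h0
    filter_upwards [ih, h1] with x hx1 hx2 hdet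
    refine hx2 ⟨hu'.sum_smul_ne_zero (i := Fin.last m) ?_, ?_⟩
    · simp only [c]
      refine mul_ne_zero (pow_ne_zero _ (by norm_num)) ?_
      rw [Matrix.submatrix_submatrix]
      convert hx1 using 3 <;>
      · ext a; simp
    · rw [zero_mul, abs_nonpos_iff, ← hdet, Matrix.det_succ_column _ (Fin.last m)]
      have := inner_sum_smul_gramMatrix u' x (fun i => c i x) j
      rw [this]
      refine Finset.sum_congr rfl fun i _ => ?_
      simp only [c, gramMatrix, Matrix.of_apply, Matrix.submatrix_apply, u', j]
      ring

theorem ae_gramMatrix_det_ne_zero {u : Fin l → EuclideanSpace ℝ (Fin n)} (hu : Orthonormal ℝ u) :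
    ∀ᵐ x ∂Measure.pi (fun _ : Fin l => stdGaussian (EuclideanSpace ℝ (Fin n))),
      (gramMatrix u x).det ≠ 0 := by
  simpa using ae_gramMatrix_minor_ne_zero hu l le_rfl

/-- Row `j` of the adjugate consists of the cofactors of column `j`, which do not involve `x j`. -/
theorem gramMatrix_adjugate_update (u : Fin l → EuclideanSpace ℝ (Fin n))
    (x : Fin l → EuclideanSpace ℝ (Fin n)) (j i : Fin l) (y : EuclideanSpace ℝ (Fin n)) :
    (gramMatrix u (Function.update x j y)).adjugate j i = (gramMatrix u x).adjugate j i := by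
  have h : ∀ x', (gramMatrix u x').adjugate j i =
      ((gramMatrix u x')ᵀ.updateRow j (Pi.single i 1)).det := fun x' => by
    rw [← Matrix.transpose_transpose (gramMatrix u x').adjugate, Matrix.adjugate_transpose,
      Matrix.transpose_apply, Matrix.adjugate_apply]
  rw [h, h]
  congr 1
  ext a b
  simp only [Matrix.updateRow_apply, Matrix.transpose_apply, gramMatrix, Matrix.of_apply]
  split_ifs with hab
  · rfl
  · rw [Function.update_of_ne hab]

/-- Cofactor expansion gives `det = ⟪w, x j⟫`, where `w` is built from row `j` of the adjugate, is
free of `x j`, and has norm at least each entry of that row. One event thus covers all `i`, and only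
`j` needs a union bound. -/
theorem pi_stdGaussian_adjugate_le {u : Fin l → EuclideanSpace ℝ (Fin n)} (hu : Orthonormal ℝ u)
    (j : Fin l) {t : ℝ} (ht : 0 ≤ t) :
    Measure.pi (fun _ : Fin l => stdGaussian (EuclideanSpace ℝ (Fin n)))
      {x | ∃ i, |(gramMatrix u x).det| < t * |(gramMatrix u x).adjugate j i|}
      ≤ ENNReal.ofReal t := by
  let w : (Fin l → EuclideanSpace ℝ (Fin n)) → EuclideanSpace ℝ (Fin n) :=
    fun x => ∑ i, (gramMatrix u x).adjugate j i • u i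
  refine le_trans (measure_mono ?_) (pi_stdGaussian_abs_inner_le (w := w)
    (Finset.measurable_sum _ fun i _ => (measurable_gramMatrix_adjugate u j i).smul_const _) j
    (fun x y => by simp only [w, gramMatrix_adjugate_update]) t)
  rintro x ⟨i, hi⟩
  have h1 : |(gramMatrix u x).adjugate j i| ≤ ‖w x‖ := by
    have h2 : inner ℝ (u i) (w x) = (gramMatrix u x).adjugate j i := by
      simp only [w]
      exact hu.inner_right_fintype _ i
    rw [← h2]
    refine (abs_real_inner_le_norm _ _).trans ?_
    rw [hu.norm_eq_one, one_mul]
  refine ⟨hu.sum_smul_ne_zero (i := i) ?_, ?_⟩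
  · intro h
    rw [h, abs_zero, mul_zero] at hi
    exact (abs_nonneg _).not_gt hi
  · have h3 : inner ℝ (w x) (x j) = (gramMatrix u x).det := by
      rw [Matrix.det_eq_sum_mul_adjugate_col _ j]
      exact inner_sum_smul_gramMatrix u x _ j
    rw [h3]
    exact hi.le.trans (mul_le_mul_of_nonneg_left h1 ht)

theorem gaussianReal_abs_ge {S : ℝ} (hS : 0 < S) :
    gaussianReal 0 1 {x | S ≤ |x|} ≤ ENNReal.ofReal (1 / S ^ 2) := by
  have h := meas_ge_le_variance_div_sq (μ := gaussianReal 0 1) (X := id)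
    (memLp_id_gaussianReal' 2 (by norm_num)) hS
  simpa using h

theorem map_pi_gaussianReal_columns :
    (Measure.pi fun _ : Fin n × Fin l => gaussianReal 0 1).map
      (fun x j => (WithLp.toLp 2 fun i => x (i, j) : EuclideanSpace ℝ (Fin n))) =
    Measure.pi fun _ : Fin l => stdGaussian (EuclideanSpace ℝ (Fin n)) := by
  have h1 : (Measure.pi fun _ : Fin n × Fin l => gaussianReal 0 1) =
      (Measure.pi fun _ : Fin l => Measure.pi fun _ : Fin n => gaussianReal 0 1).map
        (fun x p => x p.2 p.1) := by
    refine (Measure.pi_eq fun s hs => ?_)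
    rw [Measure.map_apply (by fun_prop) (MeasurableSet.univ_pi hs)]
    have h2 : (fun (x : Fin l → Fin n → ℝ) (p : Fin n × Fin l) => x p.2 p.1) ⁻¹' Set.univ.pi s =
        Set.univ.pi fun j => Set.univ.pi fun i => s (i, j) := by
      ext x
      simp only [Set.mem_preimage, Set.mem_univ_pi, Prod.forall]
      exact forall_comm
    rw [h2, Measure.pi_pi]
    simp only [Measure.pi_pi]
    rw [Fintype.prod_prod_type_right]
  rw [h1, Measure.map_map (by fun_prop) (by fun_prop), ← map_pi_eq_stdGaussian,
    ← Measure.pi_map_pi (fun _ => by fun_prop)]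
  rfl

theorem IsGaussianBlock.hasLaw_columns {Ω : Type*} [MeasurableSpace Ω] {P : Measure Ω}
    [IsProbabilityMeasure P] {X : Ω → Matrix (Fin n) (Fin l) ℝ} (hX : IsGaussianBlock P X) :
    HasLaw (fun ω (j : Fin l) => (WithLp.toLp 2 fun i => X ω i j : EuclideanSpace ℝ (Fin n)))
      (Measure.pi fun _ => stdGaussian (EuclideanSpace ℝ (Fin n))) P := by
  have hm : ∀ ij : Fin n × Fin l, AEMeasurable (fun ω => X ω ij.1 ij.2) P :=
    fun ij => (hX.law ij.1 ij.2).aemeasurable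
  have hm' : AEMeasurable (fun ω (ij : Fin n × Fin l) => X ω ij.1 ij.2) P :=
    aemeasurable_pi_lambda _ hm
  have hF : Measurable fun (x : Fin n × Fin l → ℝ) (j : Fin l) =>
      (WithLp.toLp 2 fun i => x (i, j) : EuclideanSpace ℝ (Fin n)) := by fun_prop
  refine ⟨hF.comp_aemeasurable hm', ?_⟩
  rw [← map_pi_gaussianReal_columns]
  have h := (iIndepFun_iff_map_fun_eq_pi_map hm).1 hX.indep
  simp only [fun ij : Fin n × Fin l => (hX.law ij.1 ij.2).map_eq] at h
  rw [← h, AEMeasurable.map_map_of_aemeasurable hF.aemeasurable hm']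
  rfl

/-- With high probability, a Gaussian block has a well-conditioned leading part and moderate
entries. -/
theorem IsGaussianBlock.measure_bad_le {Ω : Type*} [MeasurableSpace Ω] {P : Measure Ω}
    [IsProbabilityMeasure P] {X : Ω → Matrix (Fin n) (Fin l) ℝ} (hX : IsGaussianBlock P X)
    {u : Fin l → EuclideanSpace ℝ (Fin n)} (hu : Orthonormal ℝ u) {t S : ℝ} (ht : 0 ≤ t)
    (hS : 0 < S) :
    P {ω | ¬ ((gramMatrix u fun j => WithLp.toLp 2 fun i => X ω i j).det ≠ 0 ∧
      (∀ j i, t * |(gramMatrix u fun j => WithLp.toLp 2 fun i => X ω i j).adjugate j i| ≤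
        |(gramMatrix u fun j => WithLp.toLp 2 fun i => X ω i j).det|) ∧
      ∀ i j, |X ω i j| ≤ S)} ≤ l * ENNReal.ofReal t + n * l * ENNReal.ofReal (1 / S ^ 2) := by
  set Y : Ω → Fin l → EuclideanSpace ℝ (Fin n) := fun ω j => WithLp.toLp 2 fun i => X ω i j
  have hY := hX.hasLaw_columns
  have hpull : ∀ s, P (Y ⁻¹' s) ≤
      Measure.pi (fun _ : Fin l => stdGaussian (EuclideanSpace ℝ (Fin n))) s := fun s => by
    rw [← hY.map_eq]; exact Measure.le_map_apply hY.aemeasurable s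
  have hsub : {ω | ¬ ((gramMatrix u (Y ω)).det ≠ 0 ∧
      (∀ j i, t * |(gramMatrix u (Y ω)).adjugate j i| ≤ |(gramMatrix u (Y ω)).det|) ∧
      ∀ i j, |X ω i j| ≤ S)} ⊆ (Y ⁻¹' {x | ¬ (gramMatrix u x).det ≠ 0} ∪
      ⋃ j, Y ⁻¹' {x | ∃ i, |(gramMatrix u x).det| < t * |(gramMatrix u x).adjugate j i|}) ∪
      ⋃ ij : Fin n × Fin l, (fun ω => X ω ij.1 ij.2) ⁻¹' {x | S ≤ |x|} := by
    intro ω hω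
    simp only [Set.mem_ofPred_eq, Set.mem_union, Set.mem_preimage, Set.mem_iUnion] at hω ⊢
    by_contra! hcon
    obtain ⟨⟨h1, h2⟩, h3⟩ := hcon
    exact hω ⟨h1, h2, fun i j => (h3 (i, j)).le⟩
  refine (measure_mono hsub).trans ((measure_union_le _ _).trans (add_le_add
    ((measure_union_le _ _).trans ?_) ?_))
  · have h0 : P (Y ⁻¹' {x | ¬ (gramMatrix u x).det ≠ 0}) = 0 :=
      le_antisymm ((hpull _).trans (ae_iff.1 (ae_gramMatrix_det_ne_zero hu)).le) zero_le
    rw [h0, zero_add]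
    refine (measure_iUnion_fintype_le _ _).trans ?_
    refine (Finset.sum_le_sum fun j _ =>
      (hpull _).trans (pi_stdGaussian_adjugate_le hu j ht)).trans ?_
    simp
  · refine (measure_iUnion_fintype_le _ _).trans ?_
    refine (Finset.sum_le_sum fun ij _ =>
      (?_ : _ ≤ ENNReal.ofReal (1 / S ^ 2))).trans ?_
    · refine le_trans ?_ (gaussianReal_abs_ge hS)
      rw [← (hX.law ij.1 ij.2).map_eq]
      exact Measure.le_map_apply (hX.law ij.1 ij.2).aemeasurable _
    · simp

end Gaussian

/-! ### Choice of `p`, Krylov approximation, and bookkeeping of constants. -/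

section Assembly

/-- A large and well-separated index inside a window across which a sequence halves. -/
theorem exists_large_drop {σ : ℕ → ℝ} {k l : ℕ} {α : ℝ} (hα : 0 < α) (hk : 1 ≤ k) (hkl : k ≤ l)
    (hσk : 2 * α ≤ σ k) (hσl : σ (l + 1) ≤ α) :
    ∃ p, k ≤ p ∧ p ≤ l ∧ 3 / 2 * α ≤ σ p ∧ α / (2 * l) ≤ σ p - σ (p + 1) := by
  by_contra! hcon
  have hl : (0 : ℝ) < l := by exact_mod_cast hk.trans hkl
  set d := α / (2 * l) with hd
  have hd0 : 0 < d := by positivity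
  have hld : l * d = α / 2 := by rw [hd]; field_simp
  -- If all admissible drops were below `d`, at most `l` steps would lose at most `l * d = α / 2`.
  -- The sequence would stay above `3α/2`, even at `l + 1`.
  have key : ∀ m, m ≤ l + 1 - k → 2 * α - m * d ≤ σ (k + m) := by
    intro m
    induction m with
    | zero => intro _; simpa using hσk
    | succ m ih =>
      intro hm
      have h1 := ih (by omega)
      have hml : (m : ℝ) * d ≤ l * d :=
        mul_le_mul_of_nonneg_right (by exact_mod_cast (by omega : m ≤ l)) hd0.le
      have h2 := hcon (k + m) (by omega) (by omega) (by linarith)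
      rw [← add_assoc]
      push_cast
      linarith
  have h3 := key (l + 1 - k) le_rfl
  rw [show k + (l + 1 - k) = l + 1 by omega] at h3
  have h4 : ((l + 1 - k : ℕ) : ℝ) * d ≤ l * d :=
    mul_le_mul_of_nonneg_right (by exact_mod_cast (by omega : l + 1 - k ≤ l)) hd0.le
  linarith

/-- `P u - u` is the image of `v - u` under the contraction `id - P`, which kills `v`. -/
theorem LinearMap.IsSymmetric.norm_apply_sub_self_le {E : Type*} [NormedAddCommGroup E]
    [InnerProductSpace ℝ E] {P : E →ₗ[ℝ] E} (hP : P.IsSymmetric) (hPP : ∀ x, P (P x) = P x)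
    {v : E} (hv : P v = v) (u : E) : ‖P u - u‖ ≤ ‖v - u‖ := by
  have h1 : (LinearMap.id - P : E →ₗ[ℝ] E).IsSymmetric := LinearMap.IsSymmetric.id.sub hP
  have h2 := h1.norm_apply_le_of_idempotent (fun x => by simp [hPP]) (v - u)
  simpa [hv, neg_sub, sub_sub_sub_cancel_left] using h2

open WithLp in
theorem Matrix.l2_opNorm_le_sum_norm_col {n p : ℕ} (M : Matrix (Fin n) (Fin p) ℝ) :
    ‖M‖ ≤ ∑ j, ‖(toLp 2 fun i => M i j : EuclideanSpace ℝ (Fin n))‖ := by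
  rw [Matrix.l2_opNorm_def]
  refine ContinuousLinearMap.opNorm_le_bound _ (Finset.sum_nonneg fun _ _ => norm_nonneg _) ?_
  intro x
  have h1 : (toEuclideanLin M) x =
      ∑ j, x j • (toLp 2 fun i => M i j : EuclideanSpace ℝ (Fin n)) := by
    ext i
    simp [Matrix.toLpLin_apply, Matrix.mulVec, dotProduct, mul_comm]
  change ‖(toEuclideanLin M) x‖ ≤ _
  rw [h1, Finset.sum_mul]
  refine (norm_sum_le _ _).trans (Finset.sum_le_sum fun j _ => ?_)
  rw [norm_smul, mul_comm]
  exact mul_le_mul_of_nonneg_left (PiLp.norm_apply_le x j) (norm_nonneg _)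

theorem exists_orthonormalBasis_of_transpose_mul_self {n : ℕ} {Z : Matrix (Fin n) (Fin n) ℝ}
    (hZ : Zᵀ * Z = 1) : ∃ z : OrthonormalBasis (Fin n) ℝ (EuclideanSpace ℝ (Fin n)),
      ∀ j, z j = WithLp.toLp 2 fun i => Z i j := by
  set v : Fin n → EuclideanSpace ℝ (Fin n) := fun j => WithLp.toLp 2 fun i => Z i j with hv
  have ho : Orthonormal ℝ v := by
    rw [orthonormal_iff_ite]
    intro a b
    have := congrFun (congrFun hZ a) b
    rw [Matrix.mul_apply, Matrix.one_apply] at this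
    rw [← this]
    simp [hv, PiLp.inner_apply, mul_comm]
  have hc : Fintype.card (Fin n) = Module.finrank ℝ (EuclideanSpace ℝ (Fin n)) := by simp
  exact ⟨OrthonormalBasis.mk ho (ho.linearIndependent.span_eq_top_of_card_eq_finrank' hc).ge,
    fun j => by simp [hv]⟩

theorem toEuclideanLin_mul_apply {n : ℕ} (A B : Matrix (Fin n) (Fin n) ℝ)
    (x : EuclideanSpace ℝ (Fin n)) :
    Matrix.toEuclideanLin (A * B) x = Matrix.toEuclideanLin A (Matrix.toEuclideanLin B x) := by
  simp

theorem toEuclideanLin_pow_apply {n : ℕ} (A : Matrix (Fin n) (Fin n) ℝ) (s : ℕ)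
    (x : EuclideanSpace ℝ (Fin n)) :
    (Matrix.toEuclideanLin A ^ s) x = Matrix.toEuclideanLin (A ^ s) x := by
  induction s with
  | zero => simp
  | succ s ih => rw [pow_succ', Module.End.mul_apply, ih, pow_succ', toEuclideanLin_mul_apply]

theorem mulVec_mem_range_blockKrylov {n l q : ℕ} {A : Matrix (Fin n) (Fin n) ℝ} (hA : A.IsSymm)
    (X : Matrix (Fin n) (Fin l) ℝ) (y : Fin l → ℝ) :
    A ^ (2 * q + 1) *ᵥ (X *ᵥ y) ∈ LinearMap.range (blockKrylov A X q).mulVecLin := by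
  -- Only the last block is used: by symmetry it equals `A^(2q+1) X`.
  refine ⟨fun sj => if sj.1 = Fin.last q then y sj.2 else 0, ?_⟩
  have hpow : A ^ (2 * q + 1) = (A * Aᵀ) ^ q * A := by
    rw [hA.eq, pow_succ, pow_mul, sq]
  rw [Matrix.mulVec_mulVec, hpow]
  ext i
  simp [Matrix.mulVec, dotProduct, blockKrylov, Fintype.sum_prod_type]

theorem IsOrthonormalBasisOfRange.proj_mulVec {n r : ℕ} {κ : Type*} [Fintype κ]
    {Q : Matrix (Fin n) (Fin r) ℝ} {K : Matrix (Fin n) κ ℝ} (h : IsOrthonormalBasisOfRange Q K)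
    {v : Fin n → ℝ} (hv : v ∈ LinearMap.range K.mulVecLin) : (Q * Qᵀ) *ᵥ v = v := by
  rw [← h.range_eq] at hv
  obtain ⟨w, rfl⟩ := hv
  simp [Matrix.mul_assoc, h.orthonormal]

/-- The trial space contains a good approximation of every leading eigenvector as soon as the
leading part of the start block is well conditioned. -/
theorem exists_krylov_approx {n l q : ℕ} (hl : l ≤ n) {A : Matrix (Fin n) (Fin n) ℝ}
    (hA : A.IsSymm)
    (u : OrthonormalBasis (Fin n) ℝ (EuclideanSpace ℝ (Fin n))) {lam : Fin n → ℝ}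
    (hu : ∀ i, Matrix.toEuclideanLin A (u i) = lam i • u i)
    {X : Matrix (Fin n) (Fin l) ℝ} {t S θ : ℝ} (ht : 0 < t) (hθ : 0 ≤ θ)
    (hdet : (gramMatrix (fun i => u (Fin.castLE hl i))
      fun j => WithLp.toLp 2 fun i => X i j).det ≠ 0)
    (hadj : ∀ j i, t * |(gramMatrix (fun i => u (Fin.castLE hl i))
      fun j => WithLp.toLp 2 fun i => X i j).adjugate j i| ≤
        |(gramMatrix (fun i => u (Fin.castLE hl i)) fun j => WithLp.toLp 2 fun i => X i j).det|)
    (hX : ∀ i j, |X i j| ≤ S) {i : Fin n} (hi : lam i ≠ 0) (hil : i.val < l)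
    (hlam : ∀ a : Fin n, l ≤ a.val → |lam a| ≤ θ * |lam i|) :
    ∃ v : EuclideanSpace ℝ (Fin n),
      WithLp.ofLp v ∈ LinearMap.range (blockKrylov A X q).mulVecLin ∧
      ‖v - u i‖ ≤ n * (θ ^ (2 * q + 1) * (l * (1 / t * (n * S)))) := by
  have hT : (Matrix.toEuclideanLin A).IsSymmetric :=
    Matrix.isSymmetric_toEuclideanLin_iff.2 (by rwa [Matrix.IsHermitian,
      Matrix.conjTranspose_eq_transpose_of_trivial])
  set col : Fin l → EuclideanSpace ℝ (Fin n) := fun j => WithLp.toLp 2 fun i => X i j with hcol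
  set G := gramMatrix (fun i => u (Fin.castLE hl i)) col with hG
  -- Entries of `G⁻¹` are adjugate over determinant, hence at most `1 / t` by `hadj`.
  set y : Fin l → ℝ := fun j => G⁻¹ j ⟨i, hil⟩ with hy
  have hyb : ∀ j, |y j| ≤ 1 / t := fun j => by
    rw [hy]
    simp only [Matrix.inv_def, Ring.inverse_eq_inv', Matrix.smul_apply, smul_eq_mul, abs_mul,
      abs_inv]
    rw [inv_mul_le_iff₀ (abs_pos.2 hdet), mul_one_div, le_div_iff₀ ht, mul_comm]
    exact hadj _ _
  set x : EuclideanSpace ℝ (Fin n) := WithLp.toLp 2 (X *ᵥ y) with hx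
  have hxs : x = ∑ j, y j • col j := by
    ext a
    simp [hx, hcol, Matrix.mulVec, dotProduct, mul_comm]
  have hcoln : ∀ j, ‖col j‖ ≤ n * S := fun j =>
    (EuclideanSpace.basisFun (Fin n) ℝ).norm_le_of_abs_inner_le fun a => by
      simpa [hcol, EuclideanSpace.inner_single_left] using hX a j
  have hxn : ‖x‖ ≤ l * (1 / t * (n * S)) := by
    rw [hxs]
    refine (norm_sum_le _ _).trans ?_
    refine (Finset.sum_le_sum fun j _ => (?_ : _ ≤ 1 / t * (n * S))).trans (by simp)
    rw [norm_smul]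
    exact mul_le_mul (hyb j) (hcoln j) (norm_nonneg _) (by positivity)
  have hin : ∀ a : Fin n, a.val < l → inner ℝ (u a) x = if a = i then 1 else 0 := by
    intro a ha
    have h1 : inner ℝ (u a) x = (G * G⁻¹) ⟨a, ha⟩ ⟨i, hil⟩ := by
      rw [hxs, inner_sum, Matrix.mul_apply]
      refine Finset.sum_congr rfl fun j _ => ?_
      rw [real_inner_smul_right, mul_comm]
      rfl
    rw [h1, Matrix.mul_nonsing_inv _ (isUnit_iff_ne_zero.2 hdet), Matrix.one_apply]
    simp [Fin.ext_iff]
  refine ⟨(lam i ^ (2 * q + 1))⁻¹ • (Matrix.toEuclideanLin A ^ (2 * q + 1)) x, ?_,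
    norm_pow_smul_sub_eigenvector_le hT u hu hi hθ hin hil hlam hxn⟩
  rw [WithLp.ofLp_smul]
  refine Submodule.smul_mem _ _ ?_
  rw [toEuclideanLin_pow_apply]
  exact mulVec_mem_range_blockKrylov (q := q) hA X y

theorem norm_krylov_residual_le {n l p q r : ℕ} (hl : l ≤ n) (hpl : p ≤ l)
    {A : Matrix (Fin n) (Fin n) ℝ} (hA : A.IsSymm)
    (u : OrthonormalBasis (Fin n) ℝ (EuclideanSpace ℝ (Fin n))) {lam : Fin n → ℝ}
    (hu : ∀ i, Matrix.toEuclideanLin A (u i) = lam i • u i) (hanti : Antitone fun i => |lam i|)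
    {X : Matrix (Fin n) (Fin l) ℝ} {t S θ g : ℝ} (ht : 0 < t) (hS : 0 ≤ S) (hθ : 0 ≤ θ)
    (hg : 0 < g)
    (hdet : (gramMatrix (fun i => u (Fin.castLE hl i))
      fun j => WithLp.toLp 2 fun i => X i j).det ≠ 0)
    (hadj : ∀ j i, t * |(gramMatrix (fun i => u (Fin.castLE hl i))
      fun j => WithLp.toLp 2 fun i => X i j).adjugate j i| ≤
        |(gramMatrix (fun i => u (Fin.castLE hl i)) fun j => WithLp.toLp 2 fun i => X i j).det|)
    (hX : ∀ i j, |X i j| ≤ S) (hlam0 : ∀ i : Fin n, i.val < p → lam i ≠ 0)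
    (hlam : ∀ i a : Fin n, i.val < p → l ≤ a.val → |lam a| ≤ θ * |lam i|)
    (hgap : ∀ i j : Fin n, i.val < p → p ≤ j.val → g ≤ |lam i| - |lam j|)
    {Q : Matrix (Fin n) (Fin r) ℝ} (hQ : IsOrthonormalBasisOfRange Q (blockKrylov A X q))
    {Z : Matrix (Fin n) (Fin n) ℝ} {ev : Fin n → ℝ}
    (hZ : IsEigendecomposition (Q * Qᵀ * A * Q * Qᵀ) Z ev) {ε : ℝ}
    (hε : n * (θ ^ (2 * q + 1) * (l * (1 / t * (n * S)))) = ε) :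
    ‖A * firstCols (hpl.trans hl) Z
        - firstCols (hpl.trans hl) Z
          * Matrix.diagonal (fun i => ev (Fin.castLE (hpl.trans hl) i))‖ ≤
      n * (n * (2 * ε * ‖A‖ + 2 * ‖A‖ * (n * (2 * ε * ‖A‖ / g)))) := by
  have hT : (Matrix.toEuclideanLin A).IsSymmetric :=
    Matrix.isSymmetric_toEuclideanLin_iff.2 (by rwa [Matrix.IsHermitian,
      Matrix.conjTranspose_eq_transpose_of_trivial])
  have hP : (Matrix.toEuclideanLin (Q * Qᵀ)).IsSymmetric :=
    Matrix.isSymmetric_toEuclideanLin_iff.2 (by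
      simp [Matrix.IsHermitian, Matrix.conjTranspose_eq_transpose_of_trivial])
  have hPP : ∀ x, Matrix.toEuclideanLin (Q * Qᵀ) (Matrix.toEuclideanLin (Q * Qᵀ) x) =
      Matrix.toEuclideanLin (Q * Qᵀ) x := fun x => by
    rw [← toEuclideanLin_mul_apply]
    congr 2
    rw [Matrix.mul_assoc, ← Matrix.mul_assoc Qᵀ, hQ.orthonormal, Matrix.one_mul]
  obtain ⟨z, hz⟩ := exists_orthonormalBasis_of_transpose_mul_self hZ.orthonormal
  have hBz : ∀ j, (Matrix.toEuclideanLin (Q * Qᵀ) ∘ₗ Matrix.toEuclideanLin A ∘ₗ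
      Matrix.toEuclideanLin (Q * Qᵀ)) (z j) = ev j • z j := by
    intro j
    simp only [LinearMap.comp_apply]
    rw [← toEuclideanLin_mul_apply, ← toEuclideanLin_mul_apply, hz]
    have h1 : Q * Qᵀ * A * (Q * Qᵀ) = Q * Qᵀ * A * Q * Qᵀ := by
      simp only [Matrix.mul_assoc]
    rw [h1]
    ext i
    have h2 := congrFun (congrFun hZ.eigen i) j
    rw [Matrix.mul_diagonal, Matrix.mul_apply] at h2
    simpa [Matrix.toLpLin_apply, Matrix.mulVec, dotProduct, mul_comm, Matrix.mul_assoc] using h2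
  have hε0 : 0 ≤ ε := by rw [← hε]; positivity
  have happrox : ∀ i : Fin n, i.val < p →
      ‖Matrix.toEuclideanLin (Q * Qᵀ) (u i) - u i‖ ≤ ε := by
    intro i hi
    obtain ⟨v, hv1, hv2⟩ := exists_krylov_approx (q := q) hl hA u hu ht hθ hdet hadj hX
      (hlam0 i hi) (hi.trans_le hpl) (fun a ha => hlam i a hi ha)
    rw [hε] at hv2
    refine (hP.norm_apply_sub_self_le hPP ?_ _).trans hv2
    rw [Matrix.toLpLin_apply, hQ.proj_mulVec hv1]
  refine (Matrix.l2_opNorm_le_sum_norm_col _).trans ?_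
  have hcols : ∀ j : Fin p, ‖(WithLp.toLp 2 fun i => (A * firstCols (hpl.trans hl) Z
        - firstCols (hpl.trans hl) Z
          * Matrix.diagonal (fun i => ev (Fin.castLE (hpl.trans hl) i))) i j :
            EuclideanSpace ℝ (Fin n))‖ ≤
      n * (2 * ε * ‖A‖ + 2 * ‖A‖ * (n * (2 * ε * ‖A‖ / g))) := by
    intro j
    have h := norm_ritz_residual_le hT hP hPP u hu hanti z hBz hZ.sorted
      (N := ‖A‖) (fun x => Matrix.l2_opNorm_mulVec A x) (norm_nonneg _) hg hε0 happrox hgap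
      (j := Fin.castLE (hpl.trans hl) j) j.2
    refine le_of_eq_of_le (congrArg norm ?_) h
    rw [hz]
    ext i
    simp [firstCols, Matrix.mul_apply, Matrix.mulVec, dotProduct,
      Matrix.diagonal_apply, mul_comm]
  refine (Finset.sum_le_sum fun j _ => hcols j).trans ?_
  simp only [Finset.sum_const, Finset.card_univ, Fintype.card_fin, nsmul_eq_mul]
  refine mul_le_mul_of_nonneg_right (by exact_mod_cast hpl.trans hl) (by positivity)

/-- The bad set need not be measurable, so the complement of its measurable hull is taken. -/
theorem exists_measurableSet_compl {Ω : Type*} [MeasurableSpace Ω] (P : Measure Ω)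
    [IsProbabilityMeasure P] (B : Set Ω) {δ : ℝ} (hB : P B ≤ ENNReal.ofReal δ) (hδ : 0 ≤ δ) :
    ∃ E : Set Ω, MeasurableSet E ∧ 1 - δ ≤ P.real E ∧ ∀ ω ∈ E, ω ∉ B := by
  refine ⟨(toMeasurable P B)ᶜ, (measurableSet_toMeasurable P B).compl, ?_, fun ω hω h =>
    hω (subset_toMeasurable P B h)⟩
  rw [probReal_compl_eq_one_sub (measurableSet_toMeasurable P B), Measure.real,
    measure_toMeasurable]
  have := ENNReal.toReal_le_of_le_ofReal hδ hB
  linarith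

/-- Used with `x = n`, `a = n^(c/2)`, `b = n^(c'/2)`, `d = n^c₁`, `ρ = (2/3)^(2q+1)`, `t =
1/(2b²x)`, `S = 2xb` and gap `N/(2ax)`. The power 15 is `5 + 4` from the two estimates plus 6, as
`40 ≤ x^6` absorbs the constant. -/
theorem residual_bound_le {x l a b d ρ N ε : ℝ} (hx : 2 ≤ x) (hl : 0 ≤ l) (hlx : l ≤ x)
    (ha : 1 ≤ a) (hb : 1 ≤ b) (hd : 0 < d) (hN : 0 < N) (hρ0 : 0 ≤ ρ)
    (hρ : ρ * (a * x ^ 15 * b ^ 3 * d) ≤ 1)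
    (hε : ε = x * (ρ * (l * (1 / (1 / (2 * b ^ 2 * x)) * (x * (2 * x * b)))))) :
    x * (x * (2 * ε * N + 2 * N * (x * (2 * ε * N / (N / (2 * (a * x))))))) ≤ N / d := by
  have hε1 : ε ≤ 4 * ρ * b ^ 3 * x ^ 5 := by
    rw [hε, one_div_one_div]
    calc x * (ρ * (l * (2 * b ^ 2 * x * (x * (2 * x * b)))))
        ≤ x * (ρ * (x * (2 * b ^ 2 * x * (x * (2 * x * b))))) := by gcongr
      _ = _ := by ring
  have hε0 : 0 ≤ ε := by rw [hε]; positivity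
  have h1 : x * (x * (2 * ε * N + 2 * N * (x * (2 * ε * N / (N / (2 * (a * x))))))) =
      N * (ε * (2 * x ^ 2 + 8 * a * x ^ 4)) := by
    field_simp
    ring
  have h2 : 2 * x ^ 2 + 8 * a * x ^ 4 ≤ 10 * a * x ^ 4 := by
    have h3 : x ^ 2 ≤ x ^ 4 := pow_le_pow_right₀ (by linarith) (by norm_num)
    have h4 : x ^ 4 ≤ a * x ^ 4 := le_mul_of_one_le_left (by positivity) ha
    linarith
  have h5 : (40 : ℝ) ≤ x ^ 6 := by
    calc (40 : ℝ) ≤ 2 ^ 6 := by norm_num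
      _ ≤ x ^ 6 := by gcongr
  rw [h1, div_eq_mul_inv]
  refine mul_le_mul_of_nonneg_left ?_ hN.le
  rw [← one_div, le_div_iff₀ hd]
  calc ε * (2 * x ^ 2 + 8 * a * x ^ 4) * d
      ≤ (4 * ρ * b ^ 3 * x ^ 5) * (10 * a * x ^ 4) * d := by gcongr
    _ = ρ * (a * (x ^ 9 * 40) * b ^ 3 * d) := by ring
    _ ≤ ρ * (a * (x ^ 9 * x ^ 6) * b ^ 3 * d) := by gcongr
    _ = ρ * (a * x ^ 15 * b ^ 3 * d) := by ring
    _ ≤ 1 := hρ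

theorem pow_mul_rpow_le_one {x D : ℝ} (hx : 1 ≤ x) {q : ℕ}
    (hq : D / Real.log (9 / 4) * Real.log x ≤ q) :
    (2 / 3 : ℝ) ^ (2 * q + 1) * x ^ D ≤ 1 := by
  have hlog : 0 < Real.log (9 / 4) := Real.log_pos (by norm_num)
  have h1 : x ^ D ≤ (9 / 4 : ℝ) ^ q := by
    rw [Real.rpow_def_of_pos (by linarith), ← Real.exp_log (show (0 : ℝ) < (9 / 4) ^ q by positivity),
      Real.log_pow]
    refine Real.exp_le_exp.2 ?_
    rw [div_mul_eq_mul_div, div_le_iff₀ hlog] at hq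
    linarith
  calc (2 / 3 : ℝ) ^ (2 * q + 1) * x ^ D ≤ (2 / 3 : ℝ) ^ (2 * q + 1) * (9 / 4 : ℝ) ^ q := by gcongr
    _ = 2 / 3 * ((4 / 9) ^ q * (9 / 4) ^ q) := by rw [pow_succ, pow_mul]; norm_num; ring
    _ = 2 / 3 := by rw [← mul_pow]; norm_num
    _ ≤ 1 := by norm_num

end Assembly

theorem mainTheorem7 (c c₁ c' : ℝ) (hc : 0 < c) (hc₁ : 0 < c₁) (hc' : 0 < c') :
    ∃ C : ℝ, 0 < C ∧
      ∀ (n l k q : ℕ) (hl : l ≤ n) (A : Matrix (Fin n) (Fin n) ℝ) (α : ℝ),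
        A.IsSymm → l < A.rank →
        α = max (‖A‖ / (n : ℝ) ^ (c / 2)) (singularVal A (l + 1)) →
        1 ≤ k → k ≤ l → 2 * α ≤ singularVal A k →
        C * Real.log n ≤ q →
        ∃ (p : ℕ) (hpl : p ≤ l), k ≤ p ∧
          3 / 2 * α ≤ singularVal A p ∧
          ‖A‖ / (2 * (n : ℝ) ^ (c / 2 + 1)) ≤ singularVal A p - singularVal A (p + 1) ∧
          ∀ (Ω : Type*) [MeasurableSpace Ω] (P : Measure Ω) [IsProbabilityMeasure P]
            (X : Ω → Matrix (Fin n) (Fin l) ℝ), IsGaussianBlock P X →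
            ∃ E : Set Ω, MeasurableSet E ∧ 1 - 1 / (n : ℝ) ^ c' ≤ P.real E ∧
              ∀ ω ∈ E, ∀ (r : ℕ) (Q : Matrix (Fin n) (Fin r) ℝ),
                IsOrthonormalBasisOfRange Q (blockKrylov A (X ω) q) →
                ∀ (Z : Matrix (Fin n) (Fin n) ℝ) (ev : Fin n → ℝ),
                  IsEigendecomposition (Q * Qᵀ * A * Q * Qᵀ) Z ev →
                  ‖A * firstCols (hpl.trans hl) Z
                      - firstCols (hpl.trans hl) Z
                        * Matrix.diagonal (fun i => ev (Fin.castLE (hpl.trans hl) i))‖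
                    ≤ ‖A‖ / (n : ℝ) ^ c₁ := by
  have hlog : 0 < Real.log (9 / 4) := Real.log_pos (by norm_num)
  -- The numerator is the exponent of `n` in `a n^15 b^3 d`; the base `9/4` is `(3/2)^2`, the gain
  -- per unit of depth.
  refine ⟨(c / 2 + 15 + 3 * (c' / 2) + c₁) / Real.log (9 / 4), by positivity, ?_⟩
  intro n l k q hl A α hA hrank hα hk hkl hσk hq
  have hT : (Matrix.toEuclideanLin A).IsSymmetric :=
    Matrix.isSymmetric_toEuclideanLin_iff.2 (by rwa [Matrix.IsHermitian,
      Matrix.conjTranspose_eq_transpose_of_trivial])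
  have hln : l < n := hrank.trans_le (by simpa using A.rank_le_width)
  have hn2 : 2 ≤ n := by omega
  have hx : (2 : ℝ) ≤ n := by exact_mod_cast hn2
  have hx0 : (0 : ℝ) < n := by linarith
  have hx1 : (1 : ℝ) ≤ n := by linarith
  have hN : 0 < ‖A‖ := by
    rw [norm_pos_iff]
    rintro rfl
    simp at hrank
  set a := (n : ℝ) ^ (c / 2) with ha
  set b := (n : ℝ) ^ (c' / 2) with hb
  set d := (n : ℝ) ^ c₁ with hd
  have ha1 : 1 ≤ a := Real.one_le_rpow hx1 (by positivity)
  have hb1 : 1 ≤ b := Real.one_le_rpow hx1 (by positivity)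
  have hd0 : 0 < d := Real.rpow_pos_of_pos hx0 _
  have hax : (n : ℝ) ^ (c / 2 + 1) = a * n := by rw [Real.rpow_add hx0, Real.rpow_one]
  have hb2 : (n : ℝ) ^ c' = b ^ 2 := by
    rw [hb, ← Real.rpow_natCast, ← Real.rpow_mul hx0.le]; congr 1; push_cast; ring
  have hD : (n : ℝ) ^ (c / 2 + 15 + 3 * (c' / 2) + c₁) = a * n ^ 15 * b ^ 3 * d := by
    rw [Real.rpow_add hx0, Real.rpow_add hx0, Real.rpow_add hx0, mul_comm 3 (c' / 2),
      Real.rpow_mul hx0.le]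
    norm_cast
  have hα0 : 0 < α := hα ▸ lt_max_of_lt_left (by positivity)
  have hσl : singularVal A (l + 1) ≤ α := hα ▸ le_max_right _ _
  obtain ⟨p, hkp, hpl, hσp, hdrop⟩ := exists_large_drop hα0 hk hkl hσk hσl
  have hgap : ‖A‖ / (2 * (a * n)) ≤ singularVal A p - singularVal A (p + 1) := by
    refine le_trans ?_ hdrop
    have h1 : ‖A‖ / a ≤ α := hα ▸ le_max_left _ _
    have hl0 : (0 : ℝ) < l := by exact_mod_cast hk.trans hkl
    calc ‖A‖ / (2 * (a * n)) = ‖A‖ / a / (2 * n) := by field_simp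
      _ ≤ α / (2 * l) := by gcongr
  refine ⟨p, hpl, hkp, hσp, by rwa [hax], ?_⟩
  intro Ω _ P _ X hX
  obtain ⟨u, lam, hu, hlam⟩ := exists_eigenbasis_abs_eq_singularValues hT
    (n := n) (by simp)
  have hanti : Antitone fun i => |lam i| := fun i j hij => by
    simp only [hlam]
    exact LinearMap.singularValues_antitone _ hij
  have hlow : ∀ i : Fin n, i.val < p → singularVal A p ≤ |lam i| := fun i hi => by
    rw [hlam]
    exact LinearMap.singularValues_antitone _ (by omega)
  have hup : ∀ (m : ℕ) (i : Fin n), m ≤ i.val → |lam i| ≤ singularVal A (m + 1) :=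
    fun m i hi => by
      rw [hlam]
      exact LinearMap.singularValues_antitone _ (by omega)
  have ho : Orthonormal ℝ fun i => u (Fin.castLE hl i) :=
    u.orthonormal.comp _ (Fin.castLE_injective hl)
  have ht : 0 < 1 / (2 * b ^ 2 * n) := by positivity
  have hS : 0 < 2 * n * b := by positivity
  have hbad := hX.measure_bad_le ho ht.le hS
  -- Ill-conditioning costs at most `1/(2b²)` and large entries `1/(4b²)`, where `b² = n^c'`.
  obtain ⟨E, hE, hPE, hEB⟩ := exists_measurableSet_compl P _ (δ := 1 / (n : ℝ) ^ c')
    (hbad.trans (by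
      have h1 : (l : ℝ) ≤ n := by exact_mod_cast hl
      rw [← ENNReal.ofReal_natCast l, ← ENNReal.ofReal_natCast n,
        ← ENNReal.ofReal_mul (by positivity), ← ENNReal.ofReal_mul (by positivity),
        ← ENNReal.ofReal_mul (by positivity), ← ENNReal.ofReal_add (by positivity) (by positivity)]
      refine ENNReal.ofReal_le_ofReal ?_
      calc (l : ℝ) * (1 / (2 * b ^ 2 * n)) + n * l * (1 / (2 * n * b) ^ 2)
          ≤ n * (1 / (2 * b ^ 2 * n)) + n * n * (1 / (2 * n * b) ^ 2) := by gcongr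
        _ = 3 / 4 * (1 / b ^ 2) := by field_simp; norm_num
        _ ≤ 1 / (n : ℝ) ^ c' := by
          rw [hb2]
          exact mul_le_of_le_one_left (by positivity) (by norm_num))) (by positivity)
  refine ⟨E, hE, hPE, fun ω hω r Q hQ Z ev hZ => ?_⟩
  obtain ⟨hdet, hadj, hXS⟩ := not_not.1 (hEB ω hω)
  have hg : 0 < ‖A‖ / (2 * (a * n)) := by positivity
  -- `θ = 2/3` is the ratio of `σ_{l+1} ≤ α` to `σ_p ≥ 3α/2`.
  refine (norm_krylov_residual_le hl hpl hA u hu hanti ht hS.le (θ := 2 / 3) (by norm_num) hg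
    hdet hadj hXS (fun i hi h0 => ?_) (fun i j hi hj => ?_) (fun i j hi hj => ?_) hQ hZ rfl).trans
    (residual_bound_le hx (Nat.cast_nonneg l) (by exact_mod_cast hl) ha1 hb1 hd0 hN
      (by positivity) ?_ rfl)
  · have := hlow i hi
    rw [h0, abs_zero] at this
    linarith
  · have h1 := hlow i hi
    have h2 := hup l j hj
    linarith
  · have h1 := hlow i hi
    have h2 := hup p j hj
    linarith
  · rw [← hD]
    exact pow_mul_rpow_le_one hx1 hq
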